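/- Let $a,r,l,h>0$. Consider pairs $(\mu,\rho)$ of a Borel probability measure $\mu$ on $\mathbb{R}_x\times\mathbb{R}_u$ and a finite nonnegative Borel measure $\rho$ on $\mathbb{R}_x\times\{\pm1\}\times[0,\infty)$ (variables $(x,\gamma,\delta)$) such that $$\int\Big(\tfrac12 a f''(x)+u f'(x)\Big)\mu(dx,du)+\int Bf(x,\gamma,\delta)\,\rho(dx,d\gamma,d\delta)=0\qquad\text{for all } f\in C^2(\mathbb{R})\text{ with compact support}$$ (both integrals being well defined), where $Bf(x,\gamma,\delta)=\gamma f'(x)$, and let $$I=\inf_{(\mu,\rho)}\ \int (rx^2+lu^2)\,\mu(dx,du)+\int h|\gamma|\,\rho(dx,d\gamma,d\delta).$$ Then there exist $\iota\in(0,1)$ and $U>0$ such that the following holds. Let ${}_1F_1(\alpha;\beta;z)=\sum_{k\ge0}\frac{(\alpha)_k}{(\beta)_k}\frac{z^k}{k!}$ and $$w(x)=\begin{cases}\sqrt{rl}\,x^2-2al\ln {}_1F_1\big(\tfrac{1-\iota}{4};\tfrac12;\sqrt{r/(a^2l)}\,x^2\big),&|x|\le U,\\ w(U)+h(|x|-U),&|x|>U,\end{cases}\qquad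 u^*(x)=-\frac{w'(x)}{2l}.$$ 1. $w\in C^2(\mathbb{R})$; with $I^V=\iota a\sqrt{rl}$, for all $x\in\mathbb{R}$, $$\min\Big\{\tfrac12 a w''(x)+\inf_{u\in\mathbb{R}}\big(uw'(x)+lu^2\big)+rx^2-I^V,\ \inf_{\gamma=\pm1}\gamma w'(x)+h\Big\}=0 ;$$ and $u^*(x)$ minimises $u\mapsto \tfrac12aw''(x)+uw'(x)+rx^2+lu^2$ over $\mathbb{R}$. 2. $I=\iota a\sqrt{rl}$. 3. There is a unique $p^*\in C^2([-U,U])$ with $$\tfrac12 a p''-(u^*p)'=0\ \text{ on }(-U,U),\qquad \tfrac12 a p'-u^*p=0\ \text{ at } x=\pm U,\qquad \int_{-U}^U p\,dx=1,$$ where derivatives at the end points are one-sided. It satisfies $p^*\ge0$, and the infimum is attained at the pair $(\mu^*,\rho^*)$, which satisfies the constraint, given by $$\mu^*(dx,du)=p^*(x)\mathbf 1_{[-U,U]}(x)\,dx\otimes\delta_{u^*(x)}(du),\qquad \rho^*=\tfrac12 a\,p^*(-U)\,\delta_{(-U,1,0)}+\tfrac12 a\,p^*(U)\,\delta_{(U,-1,0)}.$$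 4. Statements 2 and 3 remain true, with the same $\iota$, $U$, $p^*$, $\mu^*$, $\rho^*$, when $B$ is replaced by the operator $Bf(x,\gamma,\delta)=\gamma f'(x)$ for $\delta=0$ and $Bf(x,\gamma,\delta)=\delta^{-1}\big(f(x+\delta\gamma)-f(x)\big)$ for $\delta>0$. -/

import Mathlib

open MeasureTheory Set
open scoped NNReal ENNReal

noncomputable section

namespace SingularLP

/-- The Kummer confluent hypergeometric function `₁F₁(a; b; z) = ∑ₖ (a)ₖ / (b)ₖ * zᵏ / k!`. -/
def kummer (a b z : ℝ) : ℝ :=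
  ∑' k : ℕ, (ascPochhammer ℝ k).eval a / (ascPochhammer ℝ k).eval b * (z ^ k / (k.factorial : ℝ))

/-- The set of directions `{+1, -1}`. -/
abbrev Dir : Type := {γ : ℝ // γ = 1 ∨ γ = -1}

/-- The direction `+1`. -/
def dirUp : Dir := ⟨1, Or.inl rfl⟩

/-- The direction `-1`. -/
def dirDown : Dir := ⟨-1, Or.inr rfl⟩

/-- Points `(x, γ, δ)` in `ℝ × {±1} × [0, ∞)`. -/
abbrev SingPt : Type := ℝ × Dir × ℝ≥0

/-- The test functions: twice continuously differentiable with compact support. -/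
def IsTest (f : ℝ → ℝ) : Prop := ContDiff ℝ 2 f ∧ HasCompactSupport f

/-- `A f (x, u) = (a / 2) f''(x) + u f'(x)`. -/
def opA (a : ℝ) (f : ℝ → ℝ) (z : ℝ × ℝ) : ℝ :=
  a / 2 * deriv (deriv f) z.1 + z.2 * deriv f z.1

/-- `B f (x, γ, δ) = γ f'(x)`, whatever `δ` is. -/
def opBGrad (f : ℝ → ℝ) (v : SingPt) : ℝ := (v.2.1 : ℝ) * deriv f v.1

/-- `B f (x, γ, δ) = γ f'(x)` if `δ = 0` and `(f (x + δ γ) - f x) / δ` if `δ > 0`. -/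
def opBJump (f : ℝ → ℝ) (v : SingPt) : ℝ :=
  if v.2.2 = 0 then (v.2.1 : ℝ) * deriv f v.1
  else ((v.2.2 : ℝ))⁻¹ * (f (v.1 + (v.2.2 : ℝ) * (v.2.1 : ℝ)) - f v.1)

/-- Feasible pairs of the linear program with operators `A` and `B`: a probability measure `μ` and
a finite measure `ρ` with `∫ A f dμ + ∫ B f dρ = 0` for every test function `f`
(both integrals being well defined). -/
structure Feasible (a : ℝ) (B : (ℝ → ℝ) → SingPt → ℝ)
    (μ : Measure (ℝ × ℝ)) (ρ : Measure SingPt) : Prop where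
  prob : IsProbabilityMeasure μ
  finite : IsFiniteMeasure ρ
  integrable_A : ∀ f, IsTest f → Integrable (opA a f) μ
  integrable_B : ∀ f, IsTest f → Integrable (B f) ρ
  constraint : ∀ f, IsTest f → ∫ z, opA a f z ∂μ + ∫ v, B f v ∂ρ = 0

/-- The cost `∫ (r x² + l u²) dμ + ∫ h |γ| dρ ∈ [0, ∞]`. -/
def cost (r l h : ℝ) (μ : Measure (ℝ × ℝ)) (ρ : Measure SingPt) : ℝ≥0∞ :=
  ∫⁻ z, ENNReal.ofReal (r * z.1 ^ 2 + l * z.2 ^ 2) ∂μ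
    + ∫⁻ v, ENNReal.ofReal (h * |(v.2.1 : ℝ)|) ∂ρ

/-- The value of the linear program: the infimum of the cost over the feasible pairs. -/
def lpValue (a r l h : ℝ) (B : (ℝ → ℝ) → SingPt → ℝ) : ℝ≥0∞ :=
  ⨅ (μ : Measure (ℝ × ℝ)) (ρ : Measure SingPt) (_ : Feasible a B μ ρ), cost r l h μ ρ

/-- `√(r l) x² - 2 a l ln ₁F₁((1 - ι)/4; 1/2; √(r / (a² l)) x²)`. -/
def innerValue (a r l ι x : ℝ) : ℝ :=
  √(r * l) * x ^ 2
    - 2 * a * l * Real.log (kummer ((1 - ι) / 4) (1 / 2) (√(r / (a ^ 2 * l)) * x ^ 2))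

/-- The function `w`: `innerValue` on `[-U, U]`, continued with slope `±h` outside. -/
def valueFn (a r l h ι U x : ℝ) : ℝ :=
  if |x| ≤ U then innerValue a r l ι x else innerValue a r l ι U + h * (|x| - U)

/-- The feedback control `u*(x) = - w'(x) / (2 l)`. -/
def optControl (a r l h ι U x : ℝ) : ℝ := -deriv (valueFn a r l h ι U) x / (2 * l)

/-- The stationary (adjoint) equation on `[-U, U]` for drift `u`, variance `a` and reflection at
both ends: `p ∈ C²([-U, U])`, `(a/2) p'' - (u p)' = 0` inside, zero flux `(a/2) p' - u p = 0` at the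
ends (with one-sided derivatives) and `∫ p = 1`. -/
structure IsReflectedDensity (a U : ℝ) (u p : ℝ → ℝ) : Prop where
  smooth : ContDiffOn ℝ 2 p (Icc (-U) U)
  ode : ∀ x ∈ Ioo (-U) U, a / 2 * deriv (deriv p) x - deriv (fun y => u y * p y) x = 0
  flux : ∀ x ∈ ({-U, U} : Set ℝ), a / 2 * derivWithin p (Icc (-U) U) x - u x * p x = 0
  mass : ∫ x in (-U)..U, p x = 1

/-- The measure `p(x) dx ⊗ δ_{u(x)}(du)`, with `p` supported on `[-U, U]`. -/
def graphMeasure (U : ℝ) (u p : ℝ → ℝ) : Measure (ℝ × ℝ) :=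
  ((volume.restrict (Icc (-U) U)).withDensity (fun x => ENNReal.ofReal (p x))).map
    (fun x => (x, u x))

/-- The measure `(a/2) p(-U) δ_{(-U, 1, 0)} + (a/2) p(U) δ_{(U, -1, 0)}`. -/
def boundaryMeasure (a U : ℝ) (p : ℝ → ℝ) : Measure SingPt :=
  ENNReal.ofReal (a / 2 * p (-U)) • Measure.dirac ((-U, dirUp, 0) : SingPt)
    + ENNReal.ofReal (a / 2 * p U) • Measure.dirac ((U, dirDown, 0) : SingPt)

/-- The Hamilton-Jacobi-Bellman equation at `x`, with ergodic constant `c`: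
`((a/2) w'' + inf_u (u w' + l u²) + r x² - c) ∧ (inf_{γ = ±1} γ w' + h) = 0`. -/
def HJBAt (a r l h c : ℝ) (w : ℝ → ℝ) (x : ℝ) : Prop :=
  min (a / 2 * deriv (deriv w) x + (⨅ u : ℝ, (u * deriv w x + l * u ^ 2)) + r * x ^ 2 - c)
    ((⨅ γ : Dir, (γ : ℝ) * deriv w x) + h) = 0

end SingularLP

end

/-! The linear program has test functions as dual unknowns, and `w` is the dual optimiser.
Integrating the HJB inequalities for `w` against a feasible pair bounds the cost below by `ι a
√(rl)` (`IsHJBSolution.le_cost`). Since `w` grows linearly it is not a test function, but `w'` and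
`w''` are bounded, so cutoffs and dominated convergence reach it (`exists_isTest_approx`).

Equality needs a feasible pair living where the inequalities are tight: the diffusion with drift `u*
= -w'/(2l)` reflected at `±U`, whose density is proportional to `exp(-w/(al))`
(`IsGibbsDensity.feasible`, `IsHJBSolution.cost_eq`). This pair charges only `δ = 0`, and both forms
of `B f` are bounded by `sup |f'|`, so one argument serves both operators.

To build `w`, the logarithm turns Kummer's equation into the Riccati equation `(a/2) w'' - w'²/(4l)
+ r x² = ι a √(rl)`. A `C²` fit to slope `h` requires `w'(U) = h` and `w''(U) = 0`; the equation
then fixes `U` in terms of `ι`, and the intermediate value theorem finds `ι`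
(`exists_innerSlope_eq`). Convexity of `w` on `[0, U]` gives `|w'| ≤ h` (`innerCurv_nonneg`). -/

namespace SingularLP

open Filter Topology

/-! ### Exponential generating functions of bounded sequences -/

/-- The exponential generating function `∑ₖ cₖ zᵏ / k!` of a sequence. -/
noncomputable def egf (c : ℕ → ℝ) (z : ℝ) : ℝ := ∑' k : ℕ, c k * (z ^ k / (k.factorial : ℝ))

lemma norm_egf_term_le {c : ℕ → ℝ} {C : ℝ} (hc : ∀ k, |c k| ≤ C) {z R : ℝ} (hz : |z| ≤ R)
    (k : ℕ) : ‖c k * (z ^ k / (k.factorial : ℝ))‖ ≤ C * (R ^ k / (k.factorial : ℝ)) := by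
  rw [Real.norm_eq_abs, abs_mul, abs_div, abs_pow, Nat.abs_cast]
  have := abs_nonneg z
  have := (abs_nonneg _).trans (hc k)
  gcongr
  exact hc k

lemma summable_egf {c : ℕ → ℝ} {C : ℝ} (hc : ∀ k, |c k| ≤ C) (z : ℝ) :
    Summable fun k : ℕ => c k * (z ^ k / (k.factorial : ℝ)) :=
  Summable.of_norm_bounded ((Real.summable_pow_div_factorial |z|).mul_left C)
    (norm_egf_term_le hc le_rfl)

/-- Termwise differentiation shifts the sequence; the shifted sequence has the same bound, so the
lemma iterates. -/
lemma hasDerivAt_egf {c : ℕ → ℝ} {C : ℝ} (hc : ∀ k, |c k| ≤ C) (z : ℝ) :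
    HasDerivAt (egf c) (egf (fun k => c (k + 1)) z) z := by
  set R : ℝ := |z| + 1
  have hsucc : ∀ (k : ℕ) (y : ℝ), c (k + 1) * (((k + 1 : ℕ) : ℝ) * y ^ (k + 1 - 1) /
      ((k + 1).factorial : ℝ)) = c (k + 1) * (y ^ k / (k.factorial : ℝ)) := by
    intro k y
    rw [Nat.factorial_succ, Nat.add_sub_cancel]
    push_cast
    have : (k.factorial : ℝ) ≠ 0 := by positivity
    field_simp
  have hu : Summable fun k : ℕ => C * ((k : ℝ) * R ^ (k - 1) / (k.factorial : ℝ)) := by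
    rw [← summable_nat_add_iff 1]
    refine ((Real.summable_pow_div_factorial R).mul_left C).congr fun k => ?_
    rw [Nat.factorial_succ, Nat.add_sub_cancel]
    push_cast
    have : (k.factorial : ℝ) ≠ 0 := by positivity
    field_simp
  have key := hasDerivAt_tsum_of_isPreconnected (t := Metric.ball (0 : ℝ) R) (y₀ := z) (y := z)
    (g := fun (k : ℕ) (y : ℝ) => c k * (y ^ k / (k.factorial : ℝ)))
    (g' := fun (k : ℕ) (y : ℝ) => c k * ((k : ℝ) * y ^ (k - 1) / (k.factorial : ℝ)))
    hu Metric.isOpen_ball (convex_ball _ _).isPreconnected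
    (fun k y _ => ((hasDerivAt_pow k y).div_const _).const_mul _)
    (fun k y hy => by
      have hy' : |y| ≤ R := by simpa using (Metric.mem_ball.1 hy).le
      rw [Real.norm_eq_abs, abs_mul, abs_div, abs_mul, abs_pow, Nat.abs_cast, Nat.abs_cast]
      have := abs_nonneg y
      have := (abs_nonneg _).trans (hc k)
      gcongr
      exact hc k)
    (by simp [R]) (summable_egf hc z) (by simp [R])
  suffices h : egf (fun k => c (k + 1)) z =
      ∑' k : ℕ, c k * ((k : ℝ) * z ^ (k - 1) / (k.factorial : ℝ)) by rw [h]; exact key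
  have hs : Summable fun k : ℕ => c k * ((k : ℝ) * z ^ (k - 1) / (k.factorial : ℝ)) := by
    rw [← summable_nat_add_iff 1]
    exact (summable_egf (c := fun k => c (k + 1)) (fun k => hc _) z).congr fun k => (hsucc k z).symm
  rw [hs.tsum_eq_zero_add]
  simp only [CharP.cast_eq_zero, zero_mul, zero_div, mul_zero, zero_add]
  exact (tsum_congr fun k => hsucc k z).symm

/-- This is the Euler operator `z d/dz`, in the form needed to compare coefficients in Kummer's
equation. -/
lemma hasSum_mul_egf_shift {c : ℕ → ℝ} {C : ℝ} (hc : ∀ k, |c k| ≤ C) (z : ℝ) :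
    HasSum (fun k : ℕ => (k : ℝ) * c k * (z ^ k / (k.factorial : ℝ)))
      (z * egf (fun k => c (k + 1)) z) := by
  rw [← hasSum_nat_add_iff' 1]
  simp only [Finset.range_one, Finset.sum_singleton, CharP.cast_eq_zero, zero_mul, sub_zero]
  refine ((summable_egf (c := fun k => c (k + 1)) (fun k => hc _) z).hasSum.mul_left z).congr_fun ?_
  intro k
  rw [Nat.factorial_succ]
  push_cast
  have : (k.factorial : ℝ) ≠ 0 := by positivity
  field_simp
  ring

/-- Coefficients and argument both vary here because `ι` will enter the Kummer function through its
parameter and through `U`. -/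
lemma continuousOn_egf {X : Type*} [TopologicalSpace X] {s : Set X} {c : X → ℕ → ℝ} {z : X → ℝ}
    {C R : ℝ} (hc : ∀ x ∈ s, ∀ k, |c x k| ≤ C) (hz : ∀ x ∈ s, |z x| ≤ R)
    (hc' : ∀ k, ContinuousOn (fun x => c x k) s) (hz' : ContinuousOn z s) :
    ContinuousOn (fun x => egf (c x) (z x)) s :=
  continuousOn_tsum (fun k => (hc' k).mul ((hz'.pow k).div_const _))
    ((Real.summable_pow_div_factorial R).mul_left C)
    (fun k x hx => norm_egf_term_le (hc x hx) (hz x hx) k)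

/-! ### The Kummer function with `0 ≤ α ≤ 1/2` and `β = 1/2` -/

/-- The ratio `(α)ₖ / (1/2)ₖ`. -/
noncomputable def kummerCoeff (α : ℝ) (k : ℕ) : ℝ :=
  (ascPochhammer ℝ k).eval α / (ascPochhammer ℝ k).eval (1 / 2)

@[simp] lemma kummerCoeff_zero (α : ℝ) : kummerCoeff α 0 = 1 := by simp [kummerCoeff]

lemma kummerCoeff_succ (α : ℝ) (k : ℕ) :
    kummerCoeff α (k + 1) = kummerCoeff α k * ((α + k) / (1 / 2 + k)) := by
  simp only [kummerCoeff, ascPochhammer_succ_eval, mul_div_mul_comm]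

lemma continuous_kummerCoeff (k : ℕ) : Continuous fun α => kummerCoeff α k :=
  (ascPochhammer ℝ k).continuous.div_const _

lemma kummerCoeff_nonneg {α : ℝ} (hα : 0 ≤ α) (k : ℕ) : 0 ≤ kummerCoeff α k := by
  induction k with
  | zero => simp
  | succ k ih => rw [kummerCoeff_succ]; positivity

lemma kummerCoeff_le_one {α : ℝ} (hα : 0 ≤ α) (hα' : α ≤ 1 / 2) (k : ℕ) :
    kummerCoeff α k ≤ 1 := by
  induction k with
  | zero => simp
  | succ k ih =>
    rw [kummerCoeff_succ]
    refine mul_le_one₀ ih (by positivity) ?_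
    rw [div_le_one (by positivity)]
    linarith

lemma abs_kummerCoeff_le {α : ℝ} (hα : 0 ≤ α) (hα' : α ≤ 1 / 2) (k : ℕ) :
    |kummerCoeff α k| ≤ 1 := by
  rw [abs_of_nonneg (kummerCoeff_nonneg hα k)]
  exact kummerCoeff_le_one hα hα' k

/-- The `n`-th derivative in `z` of `₁F₁(α; 1/2; z)`. -/
noncomputable def kummerD (n : ℕ) (α : ℝ) : ℝ → ℝ := egf fun k => kummerCoeff α (k + n)

lemma hasDerivAt_kummerD (n : ℕ) {α : ℝ} (hα : 0 ≤ α) (hα' : α ≤ 1 / 2) (z : ℝ) :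
    HasDerivAt (kummerD n α) (kummerD (n + 1) α z) z := by
  have := hasDerivAt_egf (c := fun k => kummerCoeff α (k + n))
    (fun k => abs_kummerCoeff_le hα hα' _) z
  simpa only [kummerD, add_assoc, add_comm 1 n] using this

lemma one_le_kummerD_zero {α : ℝ} (hα : 0 ≤ α) (hα' : α ≤ 1 / 2) {z : ℝ} (hz : 0 ≤ z) :
    1 ≤ kummerD 0 α z := by
  have := (summable_egf (abs_kummerCoeff_le hα hα') z).sum_le_tsum (Finset.range 1)
    (fun k _ => mul_nonneg (kummerCoeff_nonneg hα k) (by positivity))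
  simpa [kummerD, egf] using this

/-- Kummer's equation `z y'' + (1/2 - z) y' - α y = 0`. -/
lemma kummer_ode {α : ℝ} (hα : 0 ≤ α) (hα' : α ≤ 1 / 2) (z : ℝ) :
    z * kummerD 2 α z + (1 / 2 - z) * kummerD 1 α z - α * kummerD 0 α z = 0 := by
  have hb := abs_kummerCoeff_le hα hα'
  have h0 := hasSum_mul_egf_shift (c := fun k => kummerCoeff α k) hb z
  have h1 := hasSum_mul_egf_shift (c := fun k => kummerCoeff α (k + 1)) (fun k => hb _) z
  have s0 := (summable_egf hb z).hasSum.mul_left α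
  have s1 := (summable_egf (c := fun k => kummerCoeff α (k + 1)) (fun k => hb _) z).hasSum.mul_left
    (1 / 2 : ℝ)
  -- The `k`-th coefficient of the sum is `(k + 1/2) cₖ₊₁ - (k + α) cₖ`, which vanishes by the
  -- recurrence.
  have H := ((h1.add s1).sub h0).sub s0
  have hz : HasSum (fun _ : ℕ => (0 : ℝ)) 0 := hasSum_zero
  have := H.unique (hz.congr_fun fun k => ?_)
  · rw [← this]
    simp only [kummerD, add_zero, egf, add_assoc, Nat.reduceAdd]
    ring
  · simp only [kummerCoeff_succ]
    have : (1 / 2 + k : ℝ) ≠ 0 := by positivity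
    field_simp
    ring

lemma kummerD_one_eq_zero (z : ℝ) : kummerD 1 0 z = 0 := by
  have : ∀ k, kummerCoeff 0 (k + 1) = 0 := by
    intro k
    induction k with
    | zero => simp [kummerCoeff_succ]
    | succ k ih => rw [kummerCoeff_succ, ih, zero_mul]
  simp [kummerD, egf, this]

/-- The value `α = 1/4` is the end `ι = 0`. Termwise, `cₖ₊₁ / cₖ = (1/4 + k)/(1/2 + k) ≥ 1/2`. -/
lemma kummerD_zero_le {z : ℝ} (hz : 0 ≤ z) :
    kummerD 0 (1 / 4) z ≤ 2 * kummerD 1 (1 / 4) z := by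
  have hb := abs_kummerCoeff_le (α := 1 / 4) (by norm_num) (by norm_num)
  have h1 := (summable_egf (c := fun k => kummerCoeff (1 / 4) (k + 1)) (fun k => hb _) z)
  rw [kummerD, kummerD, egf, egf, ← tsum_mul_left]
  refine (summable_egf hb z).tsum_le_tsum (fun k => ?_) (h1.mul_left 2)
  have h0 := kummerCoeff_nonneg (α := 1 / 4) (by norm_num) k
  rw [kummerCoeff_succ, add_zero, ← mul_assoc]
  refine mul_le_mul_of_nonneg_right ?_ (by positivity)
  have : (1 / 2 : ℝ) ≤ (1 / 4 + k) / (1 / 2 + k) := by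
    rw [le_div_iff₀ (by positivity)]
    have : (0 : ℝ) ≤ k := by positivity
    linarith
  nlinarith

/-! ### The Riccati equation and the choice of `ι` and `U` -/

/-- The derivative of `innerValue`. -/
noncomputable def innerSlope (a r l ι x : ℝ) : ℝ :=
  2 * √(r * l) * x * (1 - 2 * (kummerD 1 ((1 - ι) / 4) (√(r / (a ^ 2 * l)) * x ^ 2) /
    kummerD 0 ((1 - ι) / 4) (√(r / (a ^ 2 * l)) * x ^ 2)))

/-- The second derivative of `innerValue`, in terms of the first. -/
noncomputable def innerCurv (a r l ι x : ℝ) : ℝ :=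
  2 / a * (innerSlope a r l ι x ^ 2 / (4 * l) - r * x ^ 2 + ι * a * √(r * l))

lemma mul_sqrt_div {a r l : ℝ} (ha : 0 < a) (hr : 0 < r) (hl : 0 < l) :
    a * l * √(r / (a ^ 2 * l)) = √(r * l) := by
  rw [eq_comm, Real.sqrt_eq_iff_mul_self_eq (by positivity) (by positivity)]
  have := Real.mul_self_sqrt (show 0 ≤ r / (a ^ 2 * l) by positivity)
  rw [mul_mul_mul_comm, this]
  field_simp

lemma hasDerivAt_innerValue {a r l ι : ℝ} (ha : 0 < a) (hr : 0 < r) (hl : 0 < l)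
    (hι : 0 ≤ ι) (hι' : ι ≤ 1) (x : ℝ) :
    HasDerivAt (innerValue a r l ι) (innerSlope a r l ι x) x := by
  have hβ := mul_sqrt_div ha hr hl
  set κ := √(r / (a ^ 2 * l)) with hκ
  have hz : HasDerivAt (fun y : ℝ => κ * y ^ 2) (κ * (2 * x)) x := by
    simpa using (hasDerivAt_pow 2 x).const_mul κ
  have hpos : 0 < kummerD 0 ((1 - ι) / 4) (κ * x ^ 2) :=
    one_pos.trans_le (one_le_kummerD_zero (by linarith) (by linarith) (by positivity))
  have hK := (hasDerivAt_kummerD 0 (α := (1 - ι) / 4) (by linarith) (by linarith)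
    (κ * x ^ 2)).comp x hz
  have := ((hasDerivAt_pow 2 x).const_mul √(r * l)).sub ((hK.log hpos.ne').const_mul (2 * a * l))
  refine this.congr_deriv ?_
  simp only [innerSlope, Function.comp_apply, ← hκ]
  rw [← hβ]
  field_simp
  push_cast
  ring

/-- Kummer's equation eliminates the second derivative of the series, leaving the Riccati equation
that defines `innerCurv`. -/
lemma hasDerivAt_innerSlope {a r l ι : ℝ} (ha : 0 < a) (hr : 0 < r) (hl : 0 < l)
    (hι : 0 ≤ ι) (hι' : ι ≤ 1) (x : ℝ) :
    HasDerivAt (innerSlope a r l ι) (innerCurv a r l ι x) x := by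
  have hβ := mul_sqrt_div ha hr hl
  have hκ2 := Real.sq_sqrt (show 0 ≤ r / (a ^ 2 * l) by positivity)
  set κ := √(r / (a ^ 2 * l)) with hκ
  have hz : HasDerivAt (fun y : ℝ => κ * y ^ 2) (κ * (2 * x)) x := by
    simpa using (hasDerivAt_pow 2 x).const_mul κ
  have hpos : 0 < kummerD 0 ((1 - ι) / 4) (κ * x ^ 2) :=
    one_pos.trans_le (one_le_kummerD_zero (by linarith) (by linarith) (by positivity))
  have hK (n : ℕ) := (hasDerivAt_kummerD n (α := (1 - ι) / 4) (by linarith) (by linarith)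
    (κ * x ^ 2)).comp x hz
  have := ((hasDerivAt_id x).const_mul (2 * √(r * l))).mul
    ((((hK 1).div (hK 0) hpos.ne').const_mul 2).const_sub 1)
  refine this.congr_deriv ?_
  simp only [innerCurv, innerSlope, Function.comp_apply, Pi.div_apply, id, ← hκ]
  have hode := kummer_ode (α := (1 - ι) / 4) (by linarith) (by linarith) (κ * x ^ 2)
  have hr' : r = a ^ 2 * l * κ ^ 2 := by rw [hκ2]; field_simp
  generalize kummerD 0 ((1 - ι) / 4) (κ * x ^ 2) = K0 at *
  generalize kummerD 1 ((1 - ι) / 4) (κ * x ^ 2) = K1 at *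
  simp only [Nat.reduceAdd]
  generalize kummerD 2 ((1 - ι) / 4) (κ * x ^ 2) = K2 at *
  rw [← hβ, hr']
  field_simp
  linear_combination (-16 * κ * K0) * hode

lemma innerValue_neg (a r l ι x : ℝ) : innerValue a r l ι (-x) = innerValue a r l ι x := by
  simp [innerValue]

lemma innerSlope_neg (a r l ι x : ℝ) : innerSlope a r l ι (-x) = -innerSlope a r l ι x := by
  simp only [innerSlope, even_two.neg_pow]
  ring

lemma innerCurv_neg (a r l ι x : ℝ) : innerCurv a r l ι (-x) = innerCurv a r l ι x := by
  simp only [innerCurv, innerSlope_neg, even_two.neg_pow]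

lemma innerSlope_one (a r l x : ℝ) : innerSlope a r l 1 x = 2 * √(r * l) * x := by
  simp [innerSlope, kummerD_one_eq_zero]

lemma innerSlope_zero_nonpos (a r l : ℝ) {x : ℝ} (hx : 0 ≤ x) : innerSlope a r l 0 x ≤ 0 := by
  have hz : 0 ≤ √(r / (a ^ 2 * l)) * x ^ 2 := by positivity
  have h1 := kummerD_zero_le hz
  have h0 := one_le_kummerD_zero (α := 1 / 4) (by norm_num) (by norm_num) hz
  rw [innerSlope, sub_zero]
  refine mul_nonpos_of_nonneg_of_nonpos (by positivity) ?_
  rw [sub_nonpos, ← mul_div_assoc, one_le_div (by linarith)]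
  exact h1

/-- There is an `ι` for which the slope reaches `h` at the point `U` where the second derivative
of `innerValue` vanishes. -/
lemma exists_innerSlope_eq {a r l h : ℝ} (ha : 0 < a) (hr : 0 < r) (hl : 0 < l) (hh : 0 < h) :
    ∃ ι ∈ Ioo (0 : ℝ) 1, ∃ U : ℝ, 0 < U ∧ r * U ^ 2 = ι * a * √(r * l) + h ^ 2 / (4 * l) ∧
      innerSlope a r l ι U = h := by
  -- `b ι` is the point where the Riccati equation allows slope `h` together with zero curvature.
  set b : ℝ → ℝ := fun ι => √((ι * a * √(r * l) + h ^ 2 / (4 * l)) / r)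
  have hb : Continuous b := by fun_prop
  have hK (n : ℕ) : ContinuousOn (fun ι : ℝ => kummerD n ((1 - ι) / 4)
      (√(r / (a ^ 2 * l)) * b ι ^ 2)) (Icc 0 1) := by
    refine continuousOn_egf (C := 1) (R := √(r / (a ^ 2 * l)) * b 1 ^ 2)
      (c := fun ι k => kummerCoeff ((1 - ι) / 4) (k + n)) ?_ ?_ ?_ ?_
    · exact fun ι hι k => abs_kummerCoeff_le (by linarith [hι.2]) (by linarith [hι.1]) _
    · intro ι hι
      rw [abs_of_nonneg (by positivity)]
      have := hι.2
      simp only [b]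
      gcongr
    · exact fun k => ((continuous_kummerCoeff _).comp (by fun_prop)).continuousOn
    · exact (by fun_prop : Continuous _).continuousOn
  have hF : ContinuousOn (fun ι => innerSlope a r l ι (b ι)) (Icc 0 1) := by
    refine ContinuousOn.mul (by fun_prop) (continuousOn_const.sub
      (continuousOn_const.mul ((hK 1).div (hK 0) fun ι hι => ?_)))
    exact (one_pos.trans_le (one_le_kummerD_zero (by linarith [hι.2]) (by linarith [hι.1])
      (by positivity))).ne'
  have hsq (ι : ℝ) (hι : 0 ≤ ι) : r * b ι ^ 2 = ι * a * √(r * l) + h ^ 2 / (4 * l) := by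
    simp only [b]
    rw [Real.sq_sqrt (by positivity)]
    field_simp
  -- At `ι = 1` the slope is linear, and its square at `b 1` is `4 l r b(1)² = 4 a l √(rl) + h²`.
  have h1 : h < innerSlope a r l 1 (b 1) := by
    rw [innerSlope_one]
    have h2 := hsq 1 zero_le_one
    have hβ2 := Real.sq_sqrt (show 0 ≤ r * l by positivity)
    refine lt_of_pow_lt_pow_left₀ 2 (by positivity) ?_
    calc h ^ 2 = 4 * l * (h ^ 2 / (4 * l)) := by field_simp
      _ < 4 * l * (1 * a * √(r * l) + h ^ 2 / (4 * l)) := by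
        have : 0 < 1 * a * √(r * l) := by positivity
        gcongr
        linarith
      _ = _ := by rw [← h2, mul_pow, mul_pow, hβ2]; ring
  obtain ⟨ι, hι, hιh⟩ := intermediate_value_Ioo zero_le_one hF
    ⟨(innerSlope_zero_nonpos a r l (Real.sqrt_nonneg _)).trans_lt hh, h1⟩
  have hι0 := hι.1
  exact ⟨ι, hι, b ι, Real.sqrt_pos.2 (by positivity), hsq ι hι.1.le, hιh⟩

lemma continuous_innerCurv {a r l ι : ℝ} (ha : 0 < a) (hr : 0 < r) (hl : 0 < l)
    (hι : 0 ≤ ι) (hι' : ι ≤ 1) : Continuous (innerCurv a r l ι) := by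
  have : Continuous (innerSlope a r l ι) := continuous_iff_continuousAt.2 fun x =>
    (hasDerivAt_innerSlope ha hr hl hι hι' x).continuousAt
  unfold innerCurv
  fun_prop

lemma innerCurv_eq_zero {a r l h ι U : ℝ} (hU : r * U ^ 2 = ι * a * √(r * l) + h ^ 2 / (4 * l))
    (hs : innerSlope a r l ι U = h) : innerCurv a r l ι U = 0 := by
  rw [innerCurv, hs, hU]
  ring

/-- Differentiating the Riccati equation gives `w''' = w' w''/(al) - 4 r x/a`. With the integrating
factor `exp(-w/(al))`, the product `w'' exp(-w/(al))` decreases on `[0, U]` to its value `0` at `U`.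
-/
lemma innerCurv_nonneg {a r l h ι U : ℝ} (ha : 0 < a) (hr : 0 < r) (hl : 0 < l)
    (hι : 0 ≤ ι) (hι' : ι ≤ 1)
    (hU : r * U ^ 2 = ι * a * √(r * l) + h ^ 2 / (4 * l))
    (hs : innerSlope a r l ι U = h) {x : ℝ} (hx : x ∈ Icc 0 U) :
    0 ≤ innerCurv a r l ι x := by
  have hd (y : ℝ) : HasDerivAt (fun y => innerCurv a r l ι y *
      Real.exp (-innerValue a r l ι y / (a * l)))
      (-(4 * r * y / a) * Real.exp (-innerValue a r l ι y / (a * l))) y := by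
    have hv := hasDerivAt_innerSlope ha hr hl hι hι' y
    have hc : HasDerivAt (innerCurv a r l ι) (2 / a * (2 * innerSlope a r l ι y *
        innerCurv a r l ι y / (4 * l) - r * (2 * y))) y := by
      have := ((((hv.pow 2).div_const (4 * l)).sub ((hasDerivAt_pow 2 y).const_mul r)).add_const
        (ι * a * √(r * l))).const_mul (2 / a)
      refine this.congr_deriv ?_
      push_cast
      ring
    refine (hc.mul ((hasDerivAt_innerValue ha hr hl hι hι' y).neg.div_const
      (a * l)).exp).congr_deriv ?_
    simp only [Pi.neg_apply]
    field_simp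
    ring
  have hanti : AntitoneOn (fun y => innerCurv a r l ι y *
      Real.exp (-innerValue a r l ι y / (a * l))) (Icc 0 U) := by
    refine antitoneOn_of_deriv_nonpos (convex_Icc _ _)
      (fun y _ => (hd y).continuousAt.continuousWithinAt)
      (fun y _ => (hd y).differentiableAt.differentiableWithinAt) fun y hy => ?_
    rw [interior_Icc] at hy
    have := hy.1
    rw [(hd y).deriv]
    exact mul_nonpos_of_nonpos_of_nonneg (neg_nonpos.2 (by positivity)) (Real.exp_nonneg _)
  have := hanti hx ⟨hx.1.trans hx.2, le_rfl⟩ hx.2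
  simp only [innerCurv_eq_zero hU hs, zero_mul] at this
  exact nonneg_of_mul_nonneg_left this (Real.exp_pos _)

lemma abs_innerSlope_le {a r l h ι U : ℝ} (ha : 0 < a) (hr : 0 < r) (hl : 0 < l)
    (hι : 0 ≤ ι) (hι' : ι ≤ 1)
    (hU : r * U ^ 2 = ι * a * √(r * l) + h ^ 2 / (4 * l))
    (hs : innerSlope a r l ι U = h) {x : ℝ} (hx : |x| ≤ U) :
    |innerSlope a r l ι x| ≤ h := by
  wlog hx0 : 0 ≤ x generalizing x
  · have := this (x := -x) (by rwa [abs_neg]) (by linarith)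
    rwa [innerSlope_neg, abs_neg] at this
  rw [abs_of_nonneg hx0] at hx
  have hd (y : ℝ) := hasDerivAt_innerSlope ha hr hl hι hι' y
  have hmono : MonotoneOn (innerSlope a r l ι) (Icc 0 U) := by
    refine monotoneOn_of_deriv_nonneg (convex_Icc _ _)
      (fun y _ => (hd y).continuousAt.continuousWithinAt)
      (fun y _ => (hd y).differentiableAt.differentiableWithinAt) fun y hy => ?_
    rw [(hd y).deriv]
    exact innerCurv_nonneg ha hr hl hι hι' hU hs (interior_subset hy)
  have h0 := hmono ⟨le_rfl, hx0.trans hx⟩ ⟨hx0, hx⟩ hx0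
  have h1 := hmono ⟨hx0, hx⟩ ⟨hx0.trans hx, le_rfl⟩ hx
  rw [show innerSlope a r l ι 0 = 0 by simp [innerSlope]] at h0
  rw [abs_of_nonneg h0]
  exact h1.trans_eq hs

/-! ### Gluing to a global `C²` solution of the HJB equation -/

lemma hasDerivAt_ite_le {F G F' G' : ℝ → ℝ} {c : ℝ} (hF : ∀ x, HasDerivAt F (F' x) x)
    (hG : ∀ x, HasDerivAt G (G' x) x) (h0 : F c = G c) (h1 : F' c = G' c) (x : ℝ) :
    HasDerivAt (fun y => if y ≤ c then F y else G y) (if x ≤ c then F' x else G' x) x := by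
  rcases lt_trichotomy x c with hx | rfl | hx
  · rw [if_pos hx.le]
    refine (hF x).congr_of_eventuallyEq ?_
    filter_upwards [Iio_mem_nhds hx] with y hy using if_pos (le_of_lt hy)
  · rw [if_pos le_rfl, ← hasDerivWithinAt_univ, ← Iic_union_Ici (a := x)]
    refine HasDerivWithinAt.union ?_ ?_
    · exact (hF x).hasDerivWithinAt.congr (fun y hy => if_pos hy) (if_pos le_rfl)
    · rw [h1]
      refine (hG x).hasDerivWithinAt.congr (fun y hy => ?_) (by rw [if_pos le_rfl, h0])
      rcases eq_or_lt_of_le (mem_Ici.1 hy) with rfl | hlt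
      · rw [if_pos le_rfl, h0]
      · exact if_neg (not_le.2 hlt)
  · rw [if_neg (not_le.2 hx)]
    refine (hG x).congr_of_eventuallyEq ?_
    filter_upwards [Ioi_mem_nhds hx] with y hy using if_neg (not_le.2 hy)

/-- `w` is a `C²` solution, with derivatives `v` and `v'`, of the HJB equation with ergodic constant
`c`, with the gradient constraint saturated exactly off `(-U, U)`. -/
structure IsHJBSolution (a r l h c U : ℝ) (w v v' : ℝ → ℝ) : Prop where
  deriv_fst : ∀ x, HasDerivAt w (v x) x
  deriv_snd : ∀ x, HasDerivAt v (v' x) x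
  continuous : Continuous v'
  bounded : ∃ K, ∀ x, |v' x| ≤ K
  abs_le : ∀ x, |v x| ≤ h
  abs_eq : ∀ x, U < |x| → |v x| = h
  right : v U = h
  left : v (-U) = -h
  eq_inside : ∀ x, |x| ≤ U → a / 2 * v' x - v x ^ 2 / (4 * l) + r * x ^ 2 = c
  ge_outside : ∀ x, U < |x| → c ≤ a / 2 * v' x - v x ^ 2 / (4 * l) + r * x ^ 2

theorem isHJBSolution_valueFn {a r l h ι U : ℝ} (ha : 0 < a) (hr : 0 < r) (hl : 0 < l)
    (hh : 0 < h) (hι : 0 ≤ ι) (hι' : ι ≤ 1) (hU0 : 0 < U)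
    (hU : r * U ^ 2 = ι * a * √(r * l) + h ^ 2 / (4 * l)) (hs : innerSlope a r l ι U = h) :
    ∃ v v', IsHJBSolution a r l h (ι * a * √(r * l)) U (valueFn a r l h ι U) v v' := by
  have hd := hasDerivAt_innerValue ha hr hl hι hι'
  have hd' := hasDerivAt_innerSlope ha hr hl hι hι'
  have hc0 := innerCurv_eq_zero hU hs
  set v : ℝ → ℝ := fun x => if x ≤ U then (if x ≤ -U then -h else innerSlope a r l ι x) else h
    with hv
  set v' : ℝ → ℝ := fun x => if x ≤ U then (if x ≤ -U then 0 else innerCurv a r l ι x) else 0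
    with hv'
  -- Two nested one-sided thresholds replace `|x| ≤ U`, so that `hasDerivAt_ite_le` applies twice.
  have hw : valueFn a r l h ι U = fun x => if x ≤ U then
      (if x ≤ -U then innerValue a r l ι U + h * (-x - U) else innerValue a r l ι x)
      else innerValue a r l ι U + h * (x - U) := by
    funext x
    simp only [valueFn, abs_le]
    split_ifs with h1 h2 h3 h4 h5
    · rw [le_antisymm h3 h1.1, innerValue_neg]; ring
    · rfl
    · exact absurd h1.2 h2
    · rw [abs_of_neg (by linarith)]
    · exact absurd ⟨by linarith, h4⟩ h1
    · rw [abs_of_pos (by linarith)]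
  have hout {x : ℝ} (hx : U < |x|) : (v x = h ∨ v x = -h) ∧ v' x = 0 := by
    simp only [hv, hv']
    rcases lt_abs.1 hx with h1 | h1
    · simp [not_le.2 h1]
    · simp [show x ≤ U by linarith, show x ≤ -U by linarith]
  have hin {x : ℝ} (hx : |x| ≤ U) : v x = innerSlope a r l ι x ∧ v' x = innerCurv a r l ι x := by
    rw [_root_.abs_le] at hx
    simp only [hv, hv', if_pos hx.2]
    rcases eq_or_lt_of_le hx.1 with h1 | h1
    · simp [← h1, innerSlope_neg, innerCurv_neg, hs, hc0]
    · simp [not_le.2 h1]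
  have hUU : ¬ U ≤ -U := by linarith
  have hcont : Continuous v' := by
    refine Continuous.if_le (Continuous.if_le continuous_const (continuous_innerCurv ha hr hl hι hι')
      continuous_id continuous_const ?_) continuous_const continuous_id continuous_const ?_
    · rintro x rfl
      rw [innerCurv_neg, hc0]
    · rintro x rfl
      rw [if_neg hUU, hc0]
  refine ⟨v, v', ?_, ?_, hcont, ?_, ?_, ?_, ?_, ?_, ?_, ?_⟩
  · rw [hw]
    refine hasDerivAt_ite_le (hasDerivAt_ite_le (F' := fun _ => -h) (fun x => ?_) hd ?_ ?_)
      (G' := fun _ => h) (fun x => ?_) ?_ ?_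
    · simpa using (((hasDerivAt_neg x).sub_const U).const_mul h).const_add (innerValue a r l ι U)
    · rw [innerValue_neg]; ring
    · rw [innerSlope_neg, hs]
    · simpa using (((hasDerivAt_id x).sub_const U).const_mul h).const_add (innerValue a r l ι U)
    · rw [if_neg hUU]; ring
    · rw [if_neg hUU, hs]
  · refine hasDerivAt_ite_le (hasDerivAt_ite_le (F' := fun _ => 0)
      (fun x => hasDerivAt_const x _) hd' ?_ ?_)
      (G' := fun _ => 0) (fun x => hasDerivAt_const x _) ?_ ?_
    · rw [innerSlope_neg, hs]
    · rw [innerCurv_neg, hc0]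
    · rw [if_neg hUU, hs]
    · rw [if_neg hUU, hc0]
  · obtain ⟨K, hK⟩ := isCompact_Icc.exists_bound_of_continuousOn (s := Icc (-U) U)
      hcont.continuousOn
    refine ⟨max K 0, fun x => ?_⟩
    rcases le_or_gt |x| U with hx | hx
    · exact (hK x (_root_.abs_le.1 hx)).trans (le_max_left _ _)
    · rw [(hout hx).2, abs_zero]
      exact le_max_right _ _
  · intro x
    rcases le_or_gt |x| U with hx | hx
    · rw [(hin hx).1]
      exact abs_innerSlope_le ha hr hl hι hι' hU hs hx
    · rcases (hout hx).1 with h1 | h1 <;> simp [h1, abs_of_pos hh]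
  · intro x hx
    rcases (hout hx).1 with h1 | h1 <;> simp [h1, abs_of_pos hh]
  · rw [(hin (abs_of_pos hU0).le).1, hs]
  · rw [(hin (by rw [abs_neg, abs_of_pos hU0])).1, innerSlope_neg, hs]
  · intro x hx
    rw [(hin hx).1, (hin hx).2, innerCurv]
    field_simp
    ring
  -- Outside, slope and curvature keep their squared and zero values from `±U`, while `r x²` only
  -- grows.
  · intro x hx
    have h2 : v x ^ 2 = h ^ 2 := by rcases (hout hx).1 with h1 | h1 <;> simp [h1]
    have h3 : r * U ^ 2 ≤ r * x ^ 2 := by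
      rw [← sq_abs x]
      gcongr
    rw [h2, (hout hx).2]
    linarith

lemma mul_add_mul_sq_eq {l : ℝ} (hl : 0 < l) (u y : ℝ) :
    u * y + l * u ^ 2 = l * (u + y / (2 * l)) ^ 2 - y ^ 2 / (4 * l) := by
  field_simp
  ring

lemma contDiff_two_of_hasDerivAt {f f' f'' : ℝ → ℝ} (h1 : ∀ x, HasDerivAt f (f' x) x)
    (h2 : ∀ x, HasDerivAt f' (f'' x) x) (h3 : Continuous f'') : ContDiff ℝ 2 f := by
  have e1 : deriv f = f' := funext fun x => (h1 x).deriv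
  have e2 : deriv f' = f'' := funext fun x => (h2 x).deriv
  rw [show (2 : WithTop ℕ∞) = 1 + 1 from rfl, contDiff_succ_iff_deriv, e1]
  refine ⟨fun x => (h1 x).differentiableAt, by simp,
    contDiff_one_iff_deriv.2 ⟨fun x => (h2 x).differentiableAt, ?_⟩⟩
  rwa [e2]

namespace IsHJBSolution

variable {a r l h c U : ℝ} {w v v' : ℝ → ℝ}

lemma deriv_eq (hs : IsHJBSolution a r l h c U w v v') : deriv w = v :=
  funext fun x => (hs.deriv_fst x).deriv

lemma deriv_deriv_eq (hs : IsHJBSolution a r l h c U w v v') : deriv (deriv w) = v' := by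
  rw [hs.deriv_eq]
  exact funext fun x => (hs.deriv_snd x).deriv

lemma continuous_fst (hs : IsHJBSolution a r l h c U w v v') : Continuous v :=
  continuous_iff_continuousAt.2 fun x => (hs.deriv_snd x).continuousAt

lemma contDiff (hs : IsHJBSolution a r l h c U w v v') : ContDiff ℝ 2 w :=
  contDiff_two_of_hasDerivAt hs.deriv_fst hs.deriv_snd hs.continuous

lemma le_hamiltonian (hs : IsHJBSolution a r l h c U w v v') (x : ℝ) :
    c ≤ a / 2 * v' x - v x ^ 2 / (4 * l) + r * x ^ 2 := by
  rcases le_or_gt |x| U with hx | hx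
  · exact (hs.eq_inside x hx).ge
  · exact hs.ge_outside x hx

lemma hjbAt (hs : IsHJBSolution a r l h c U w v v') (hl : 0 < l) (x : ℝ) :
    HJBAt a r l h c w x := by
  have h1 : (⨅ u : ℝ, (u * v x + l * u ^ 2)) = -(v x ^ 2 / (4 * l)) := by
    have key (u : ℝ) := mul_add_mul_sq_eq hl u (v x)
    have : IsLeast (range fun u : ℝ => u * v x + l * u ^ 2) (-(v x ^ 2 / (4 * l))) := by
      refine ⟨⟨-(v x / (2 * l)), ?_⟩, ?_⟩
      · simp only [key]
        ring
      · rintro _ ⟨u, rfl⟩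
        simp only [key]
        have : 0 ≤ l * (u + v x / (2 * l)) ^ 2 := by positivity
        linarith
    exact this.csInf_eq
  have h2 : (⨅ γ : Dir, (γ : ℝ) * v x) = -|v x| := by
    have : IsLeast (range fun γ : Dir => (γ : ℝ) * v x) (-|v x|) := by
      refine ⟨?_, ?_⟩
      · rcases abs_cases (v x) with h | h
        · exact ⟨dirDown, by simp [dirDown, h.1]⟩
        · exact ⟨dirUp, by simp [dirUp, h.1]⟩
      · rintro _ ⟨⟨γ, rfl | rfl⟩, rfl⟩
        · simpa using neg_abs_le (v x)
        · simpa using le_abs_self (v x)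
    exact this.csInf_eq
  rw [HJBAt, hs.deriv_deriv_eq, hs.deriv_eq, h1, h2]
  have h3 := hs.le_hamiltonian x
  have h4 := hs.abs_le x
  rcases le_or_gt |x| U with hx | hx
  · have := hs.eq_inside x hx
    rw [min_eq_left] <;> linarith
  · have := hs.abs_eq x hx
    rw [min_eq_right] <;> linarith

lemma isMinOn (hs : IsHJBSolution a r l h c U w v v') (hl : 0 < l) (x : ℝ) :
    IsMinOn (fun u => opA a w (x, u) + (r * x ^ 2 + l * u ^ 2)) univ
      (-deriv w x / (2 * l)) := by
  intro u _
  have k1 := mul_add_mul_sq_eq hl u (v x)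
  have k2 := mul_add_mul_sq_eq hl (-v x / (2 * l)) (v x)
  have k3 : -v x / (2 * l) + v x / (2 * l) = 0 := by ring
  have : 0 ≤ l * (u + v x / (2 * l)) ^ 2 := by positivity
  rw [k3] at k2
  simp only [opA, mem_ofPred_eq, hs.deriv_eq]
  linarith

end IsHJBSolution

/-! ### Truncation to test functions and weak duality -/

/-- A smooth cutoff function with its first two derivatives. -/
lemma exists_cutoff : ∃ χ χ' χ'' : ℝ → ℝ, ContDiff ℝ 2 χ ∧ HasCompactSupport χ ∧
    (∀ x, HasDerivAt χ (χ' x) x) ∧ (∀ x, HasDerivAt χ' (χ'' x) x) ∧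
    (∀ x, |x| < 1 → χ x = 1) ∧
    ∃ K, ∀ x, |χ x| ≤ K ∧ |χ' x| ≤ K ∧ |x * χ' x| ≤ K ∧ |χ'' x| ≤ K ∧ |x * χ'' x| ≤ K := by
  let b : ContDiffBump (0 : ℝ) := ⟨1, 2, one_pos, one_lt_two⟩
  have h2 : ContDiff ℝ 2 b := b.contDiff
  have h1 : ContDiff ℝ 1 (deriv b) := h2.iterate_deriv' 1 1
  have h0 : Continuous (deriv (deriv b)) := h1.continuous_deriv_one
  have s0 : HasCompactSupport b := b.hasCompactSupport
  have s1 : HasCompactSupport (deriv b) := s0.deriv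
  have s2 : HasCompactSupport (deriv (deriv b)) := s1.deriv
  obtain ⟨K0, hK0⟩ := s0.exists_bound_of_continuous b.continuous
  obtain ⟨K1, hK1⟩ := s1.exists_bound_of_continuous h1.continuous
  obtain ⟨K2, hK2⟩ := s2.exists_bound_of_continuous h0
  obtain ⟨K3, hK3⟩ := (s1.mul_left (f := fun x => x)).exists_bound_of_continuous
    (continuous_id.mul h1.continuous)
  obtain ⟨K4, hK4⟩ := (s2.mul_left (f := fun x => x)).exists_bound_of_continuous
    (continuous_id.mul h0)
  refine ⟨b, deriv b, deriv (deriv b), h2, s0,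
    fun x => (h2.differentiable (by simp) x).hasDerivAt,
    fun x => (h1.differentiable (by simp) x).hasDerivAt, fun x hx => ?_,
    max K0 (max K1 (max K2 (max K3 K4))), fun x => ?_⟩
  · exact b.one_of_mem_closedBall (by simpa [b] using hx.le)
  · have a0 := hK0 x
    have a1 := hK1 x
    have a2 := hK2 x
    have a3 := hK3 x
    have a4 := hK4 x
    simp only [Real.norm_eq_abs, Pi.mul_apply] at a0 a1 a2 a3 a4
    simp only [le_max_iff]
    tauto

/-- A `C²` function with bounded first and second derivatives is the local limit of test functions
with uniformly bounded first and second derivatives. -/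
lemma exists_isTest_approx {w v v' : ℝ → ℝ} (h1 : ∀ x, HasDerivAt w (v x) x)
    (h2 : ∀ x, HasDerivAt v (v' x) x) (h3 : Continuous v') {M : ℝ} (hv : ∀ x, |v x| ≤ M)
    (hv' : ∀ x, |v' x| ≤ M) :
    ∃ f : ℕ → ℝ → ℝ, ∃ K, (∀ n, IsTest (f n)) ∧ (∀ n x, |deriv (f n) x| ≤ K) ∧
      (∀ n x, |deriv (deriv (f n)) x| ≤ K) ∧ ∀ x, ∀ᶠ n in atTop, f n =ᶠ[𝓝 x] w := by
  obtain ⟨χ, χ', χ'', hχ, sχ, d1, d2, hone, K, hK⟩ := exists_cutoff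
  have hK0 : 0 ≤ K := (abs_nonneg _).trans (hK 0).1
  have hM0 : 0 ≤ M := (abs_nonneg _).trans (hv 0)
  have hw (x : ℝ) : |w x| ≤ |w 0| + M * |x| := by
    have := convex_univ.norm_image_sub_le_of_norm_hasDerivWithin_le (f := w) (f' := v) (C := M)
      (x := 0) (y := x) (fun y _ => (h1 y).hasDerivWithinAt) (fun y _ => hv y) (mem_univ _)
      (mem_univ _)
    rw [Real.norm_eq_abs, Real.norm_eq_abs, sub_zero] at this
    have h := abs_sub_abs_le_abs_sub (w x) (w 0)
    linarith
  have hwc : ContDiff ℝ 2 w := contDiff_two_of_hasDerivAt h1 h2 h3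
  have hs (n : ℕ) : (0 : ℝ) < ((n : ℝ) + 1)⁻¹ := by positivity
  have hs1 (n : ℕ) : ((n : ℝ) + 1)⁻¹ ≤ 1 :=
    inv_le_one_of_one_le₀ (by have : (0 : ℝ) ≤ n := by positivity
                              linarith)
  set s : ℕ → ℝ := fun n => ((n : ℝ) + 1)⁻¹
  have e1 (n : ℕ) (x : ℝ) : HasDerivAt (fun y => w y * χ (s n * y))
      (v x * χ (s n * x) + s n * (w x * χ' (s n * x))) x := by
    have hc : HasDerivAt (fun y => χ (s n * y)) (χ' (s n * x) * s n) x :=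
      (d1 (s n * x)).comp x (by simpa using (hasDerivAt_id x).const_mul (s n))
    exact ((h1 x).mul hc).congr_deriv (by ring)
  have e2 (n : ℕ) (x : ℝ) : HasDerivAt
      (fun y => v y * χ (s n * y) + s n * (w y * χ' (s n * y)))
      (v' x * χ (s n * x) + 2 * (s n * (v x * χ' (s n * x))) +
        s n * (s n * (w x * χ'' (s n * x)))) x := by
    have hi : HasDerivAt (fun y => s n * y) (s n) x := by
      simpa using (hasDerivAt_id x).const_mul (s n)
    have hc : HasDerivAt (fun y => χ (s n * y)) (χ' (s n * x) * s n) x :=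
      (d1 (s n * x)).comp x hi
    have hc' : HasDerivAt (fun y => χ' (s n * y)) (χ'' (s n * x) * s n) x :=
      (d2 (s n * x)).comp x hi
    exact (((h2 x).mul hc).add (((h1 x).mul hc').const_mul (s n))).congr_deriv (by ring)
  -- The linear growth of `w` is absorbed by the scale `s n` and the bound on `y * g y`, uniformly
  -- in `n`.
  have hsw (g : ℝ → ℝ) (hg : ∀ x, |g x| ≤ K ∧ |x * g x| ≤ K) (n : ℕ) (x : ℝ) :
      |s n * (w x * g (s n * x))| ≤ (|w 0| + M) * K := by
    have hg1 := (hg (s n * x)).1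
    have hg2 := (hg (s n * x)).2
    rw [abs_mul, abs_mul, abs_of_pos (hs n)] at hg2
    rw [abs_mul, abs_mul, abs_of_pos (hs n)]
    calc s n * (|w x| * |g (s n * x)|)
        ≤ s n * ((|w 0| + M * |x|) * |g (s n * x)|) := by
          have := (hs n).le
          gcongr
          exact hw x
      _ = |w 0| * (s n * |g (s n * x)|) + M * (s n * |x| * |g (s n * x)|) := by ring
      _ ≤ |w 0| * (1 * K) + M * K := by
          gcongr
          exact hs1 n
      _ = _ := by ring
  have E1 (n : ℕ) : deriv (fun y => w y * χ (s n * y)) =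
      fun x => v x * χ (s n * x) + s n * (w x * χ' (s n * x)) := funext fun x => (e1 n x).deriv
  have b1 (n : ℕ) (x : ℝ) : |v x * χ (s n * x)| ≤ M * K := by
    rw [abs_mul]
    exact mul_le_mul (hv x) (hK _).1 (abs_nonneg _) hM0
  have b2 (n : ℕ) (x : ℝ) : |v' x * χ (s n * x)| ≤ M * K := by
    rw [abs_mul]
    exact mul_le_mul (hv' x) (hK _).1 (abs_nonneg _) hM0
  have b3 (n : ℕ) (x : ℝ) : |s n * (v x * χ' (s n * x))| ≤ M * K := by
    rw [abs_mul, abs_mul, abs_of_pos (hs n)]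
    calc _ ≤ 1 * (M * K) := by
          gcongr
          exacts [hs1 n, hv x, (hK _).2.1]
      _ = _ := one_mul _
  have hw0 := abs_nonneg (w 0)
  refine ⟨fun n y => w y * χ (s n * y), 3 * (M * K) + (|w 0| + M) * K, fun n => ⟨?_, ?_⟩,
    fun n x => ?_, fun n x => ?_, fun x => ?_⟩
  · exact hwc.mul (hχ.comp (contDiff_const.mul contDiff_id))
  · exact (sχ.comp_homeomorph (Homeomorph.mulLeft₀ (s n) (hs n).ne')).mul_left
  · rw [E1]
    refine (abs_add_le _ _).trans ?_
    have := hsw χ' (fun x => ⟨(hK x).2.1, (hK x).2.2.1⟩) n x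
    have := b1 n x
    have : 0 ≤ M * K := by positivity
    linarith
  · rw [E1, (e2 n x).deriv]
    refine (abs_add_le _ _).trans (add_le_add ((abs_add_le _ _).trans ?_) ?_)
    · rw [abs_mul 2, abs_two]
      have := b2 n x
      have := b3 n x
      linarith
    · rw [abs_mul, abs_of_pos (hs n)]
      have := hsw χ'' (fun x => ⟨(hK x).2.2.2.1, (hK x).2.2.2.2⟩) n x
      exact (mul_le_of_le_one_left (abs_nonneg _) (hs1 n)).trans this
  · obtain ⟨N, hN⟩ := exists_nat_gt |x|
    filter_upwards [eventually_ge_atTop N] with n hn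
    have hxn : |x| < (n : ℝ) + 1 := by
      have : (N : ℝ) ≤ n := by exact_mod_cast hn
      linarith
    have : ∀ᶠ y in 𝓝 x, |y| < (n : ℝ) + 1 :=
      continuous_abs.continuousAt.eventually_lt continuousAt_const hxn
    filter_upwards [this] with y hy
    rw [hone, mul_one]
    rw [abs_mul, abs_of_pos (hs n), inv_mul_lt_one₀ (by positivity)]
    exact hy

/-- The properties shared by the two singular operators. -/
structure IsDirectional (B : (ℝ → ℝ) → SingPt → ℝ) : Prop where
  bound : ∀ (f : ℝ → ℝ) (K : ℝ), Differentiable ℝ f → (∀ x, |deriv f x| ≤ K) →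
    ∀ z, |B f z| ≤ K
  -- Dependence on germs at only two points makes `B (f n) z` eventually equal to `B w z`.
  congr : ∀ z, ∃ x y, ∀ f g : ℝ → ℝ, f =ᶠ[𝓝 x] g → f =ᶠ[𝓝 y] g → B f z = B g z

lemma abs_dir (γ : Dir) : |(γ : ℝ)| = 1 := by
  rcases γ with ⟨γ, rfl | rfl⟩ <;> simp

lemma isDirectional_opBGrad : IsDirectional opBGrad where
  bound f K _ hK z := by
    rw [opBGrad, abs_mul, abs_dir, one_mul]
    exact hK _
  congr z := ⟨z.1, z.1, fun f g h _ => by rw [opBGrad, opBGrad, h.deriv_eq]⟩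

/-- The difference quotient is controlled by the mean value inequality, uniformly in `δ`. -/
lemma isDirectional_opBJump : IsDirectional opBJump where
  bound f K hf hK z := by
    rw [opBJump]
    split_ifs with h
    · rw [abs_mul, abs_dir, one_mul]
      exact hK _
    · have hδ : (0 : ℝ) < z.2.2 := by
        have : 0 < z.2.2 := pos_iff_ne_zero.2 h
        exact_mod_cast this
      have := convex_univ.norm_image_sub_le_of_norm_deriv_le (f := f) (C := K)
        (x := z.1) (y := z.1 + (z.2.2 : ℝ) * (z.2.1 : ℝ)) (fun y _ => hf y) (fun y _ => hK y)
        (mem_univ _) (mem_univ _)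
      rw [add_sub_cancel_left, Real.norm_eq_abs, Real.norm_eq_abs, abs_mul (z.2.2 : ℝ), abs_dir,
        mul_one, abs_of_pos hδ] at this
      rw [abs_mul, abs_inv, abs_of_pos hδ, inv_mul_le_iff₀ hδ]
      linarith
  congr z := ⟨z.1, z.1 + (z.2.2 : ℝ) * (z.2.1 : ℝ), fun f g h h' => by
    rw [opBJump, opBJump, h.deriv_eq, h.self_of_nhds, h'.self_of_nhds]⟩

/-- Weak duality: a solution of the HJB equation bounds the linear program from below. -/
theorem IsHJBSolution.le_cost {a r l h c U : ℝ} {w v v' : ℝ → ℝ}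
    (hs : IsHJBSolution a r l h c U w v v') (hr : 0 < r) (hl : 0 < l) (hh : 0 < h)
    {B : (ℝ → ℝ) → SingPt → ℝ} (hB : IsDirectional B) {μ : Measure (ℝ × ℝ)} {ρ : Measure SingPt}
    (hf : Feasible a B μ ρ) : ENNReal.ofReal c ≤ cost r l h μ ρ := by
  have := hf.prob
  have := hf.finite
  -- Infinite running cost is trivial; finite cost makes `u` integrable, which supplies the
  -- dominating function below.
  rcases eq_or_ne (∫⁻ z, ENNReal.ofReal (r * z.1 ^ 2 + l * z.2 ^ 2) ∂μ) ⊤ with htop | htop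
  · rw [cost, htop, top_add]
    exact le_top
  have hg0 (z : ℝ × ℝ) : 0 ≤ r * z.1 ^ 2 + l * z.2 ^ 2 := by positivity
  have hint : Integrable (fun z : ℝ × ℝ => r * z.1 ^ 2 + l * z.2 ^ 2) μ := by
    refine ⟨(by fun_prop : Continuous _).aestronglyMeasurable, ?_⟩
    rw [hasFiniteIntegral_iff_ofReal (ae_of_all _ hg0)]
    exact htop.lt_top
  have hu : Integrable (fun z : ℝ × ℝ => |z.2|) μ := by
    refine ((integrable_const (1 : ℝ)).add (hint.const_mul l⁻¹)).mono'
      (by fun_prop : Continuous _).aestronglyMeasurable (ae_of_all _ fun z => ?_)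
    have h1 : z.2 ^ 2 ≤ l⁻¹ * (r * z.1 ^ 2 + l * z.2 ^ 2) := by
      rw [le_inv_mul_iff₀ hl]
      have : 0 ≤ r * z.1 ^ 2 := by positivity
      linarith
    rw [Real.norm_eq_abs, abs_abs]
    simp only [Pi.add_apply]
    nlinarith [sq_nonneg (|z.2| - 1), sq_abs z.2, abs_nonneg z.2]
  obtain ⟨M, hM⟩ := hs.bounded
  obtain ⟨f, K, hft, hK1, hK2, hloc⟩ := exists_isTest_approx hs.deriv_fst hs.deriv_snd
    hs.continuous (M := max h M) (fun x => (hs.abs_le x).trans (le_max_left _ _))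
    (fun x => (hM x).trans (le_max_right _ _))
  set g : ℝ × ℝ → ℝ := opA a w with hg
  have hgint_bound : Integrable (fun z : ℝ × ℝ => |a / 2| * K + |z.2| * K) μ :=
    (integrable_const _).add (hu.mul_const _)
  have hAle (n : ℕ) (z : ℝ × ℝ) : ‖opA a (f n) z‖ ≤ |a / 2| * K + |z.2| * K := by
    rw [opA, Real.norm_eq_abs]
    refine (abs_add_le _ _).trans ?_
    rw [abs_mul, abs_mul]
    gcongr
    exacts [hK2 n _, hK1 n _]
  have hAlim (z : ℝ × ℝ) : ∀ᶠ n in atTop, opA a (f n) z = g z := by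
    filter_upwards [hloc z.1] with n hn
    rw [hg, opA, opA, hn.deriv.deriv_eq, hn.deriv_eq]
  have hBlim (z : SingPt) : ∀ᶠ n in atTop, B (f n) z = B w z := by
    obtain ⟨x, y, hxy⟩ := hB.congr z
    filter_upwards [hloc x, hloc y] with n h1 h2 using hxy _ _ h1 h2
  have hBle (n : ℕ) (z : SingPt) : ‖B (f n) z‖ ≤ K :=
    hB.bound (f n) K ((hft n).1.differentiable (by simp)) (hK1 n) z
  have hTA : Tendsto (fun n => ∫ z, opA a (f n) z ∂μ) atTop (𝓝 (∫ z, g z ∂μ)) :=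
    tendsto_integral_of_dominated_convergence _
      (fun n => (hf.integrable_A _ (hft n)).aestronglyMeasurable) hgint_bound
      (fun n => ae_of_all _ (hAle n))
      (ae_of_all _ fun z => tendsto_nhds_of_eventually_eq (hAlim z))
  have hTB : Tendsto (fun n => ∫ z, B (f n) z ∂ρ) atTop (𝓝 (∫ z, B w z ∂ρ)) :=
    tendsto_integral_of_dominated_convergence _
      (fun n => (hf.integrable_B _ (hft n)).aestronglyMeasurable) (integrable_const K)
      (fun n => ae_of_all _ (hBle n))
      (ae_of_all _ fun z => tendsto_nhds_of_eventually_eq (hBlim z))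
  have hsum : ∫ z, g z ∂μ + ∫ z, B w z ∂ρ = 0 := by
    refine tendsto_nhds_unique (hTA.add hTB) ?_
    simp only [fun n => hf.constraint _ (hft n)]
    exact tendsto_const_nhds
  have hgint : Integrable g μ := by
    refine hgint_bound.mono' (aestronglyMeasurable_of_tendsto_ae atTop
      (fun n => (hf.integrable_A _ (hft n)).aestronglyMeasurable)
      (ae_of_all _ fun z => tendsto_nhds_of_eventually_eq (hAlim z))) (ae_of_all _ fun z => ?_)
    obtain ⟨n, hn⟩ := (hAlim z).exists
    rw [← hn]
    exact hAle n z
  -- For abstract `B`, measurability of `B w` is inherited from the test functions in the limit.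
  have hBint : Integrable (B w) ρ := by
    refine (integrable_const K).mono' (aestronglyMeasurable_of_tendsto_ae atTop
      (fun n => (hf.integrable_B _ (hft n)).aestronglyMeasurable)
      (ae_of_all _ fun z => tendsto_nhds_of_eventually_eq (hBlim z))) (ae_of_all _ fun z => ?_)
    obtain ⟨n, hn⟩ := (hBlim z).exists
    rw [← hn]
    exact hBle n z
  have hBw (z : SingPt) : |B w z| ≤ h :=
    hB.bound w h (fun x => (hs.deriv_fst x).differentiableAt)
      (fun x => by rw [hs.deriv_eq]; exact hs.abs_le x) z
  -- Completing the square in `u` bounds the integrand below by the minimised Hamiltonian, which is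
  -- at least `c`.
  have h1 : c ≤ ∫ z, g z ∂μ + ∫ z : ℝ × ℝ, (r * z.1 ^ 2 + l * z.2 ^ 2) ∂μ := by
    rw [← integral_add hgint hint]
    calc c = ∫ _, c ∂μ := by simp
      _ ≤ _ := by
        refine integral_mono (integrable_const c) (hgint.add hint) fun z => ?_
        have h2 := hs.le_hamiltonian z.1
        have h3 := mul_add_mul_sq_eq hl z.2 (v z.1)
        have h4 : 0 ≤ l * (z.2 + v z.1 / (2 * l)) ^ 2 := by positivity
        simp only [hg, opA, hs.deriv_eq, (hs.deriv_snd _).deriv]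
        linarith
  have h2 : 0 ≤ ∫ z, B w z ∂ρ + ∫ z : SingPt, h * |(z.2.1 : ℝ)| ∂ρ := by
    simp only [abs_dir, mul_one]
    rw [← integral_add hBint (integrable_const h)]
    refine integral_nonneg fun z => ?_
    have := (_root_.abs_le.1 (hBw z)).1
    simp only [Pi.zero_apply]
    linarith
  rw [cost, ← ofReal_integral_eq_lintegral_ofReal hint (ae_of_all _ hg0),
    ← ofReal_integral_eq_lintegral_ofReal (by simp only [abs_dir]; exact integrable_const _)
      (ae_of_all _ fun z => by positivity),
    ← ENNReal.ofReal_add (integral_nonneg hg0) (integral_nonneg fun z => by positivity)]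
  exact ENNReal.ofReal_le_ofReal (by linarith)

/-! ### The reflected stationary density -/

/-- The properties of a positive reflected density: `p` solves `(a/2) p' = u p`. -/
structure IsGibbsDensity (a U : ℝ) (u p : ℝ → ℝ) : Prop where
  pos : ∀ x, 0 < p x
  hasDerivAt : ∀ x, HasDerivAt p (2 / a * (u x * p x)) x
  mass : ∫ x in (-U)..U, p x = 1

/-- A function with vanishing derivative inside an interval is constant. -/
lemma eq_left_of_hasDerivAt_zero {f : ℝ → ℝ} {b U : ℝ} (hf : ContinuousOn f (Icc b U))
    (hd : ∀ x ∈ Ioo b U, HasDerivAt f 0 x) {x : ℝ} (hx : x ∈ Icc b U) : f x = f b := by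
  have := intervalIntegral.integral_eq_sub_of_hasDerivAt_of_le hx.1
    (hf.mono (Icc_subset_Icc_right hx.2)) (f' := fun _ => 0)
    (fun y hy => hd y ⟨hy.1, hy.2.trans_le hx.2⟩) (by simp)
  rw [intervalIntegral.integral_zero] at this
  linarith

namespace IsGibbsDensity

variable {a U : ℝ} {u u' p : ℝ → ℝ}

lemma continuous (hp : IsGibbsDensity a U u p) : Continuous p :=
  continuous_iff_continuousAt.2 fun x => (hp.hasDerivAt x).continuousAt

lemma isReflectedDensity (hp : IsGibbsDensity a U u p) (ha : 0 < a) (hU : 0 < U)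
    (hu : ∀ x, HasDerivAt u (u' x) x) (hu' : Continuous u') :
    IsReflectedDensity a U u p := by
  have huc : Continuous u := continuous_iff_continuousAt.2 fun x => (hu x).continuousAt
  have h2 (x : ℝ) := ((hu x).mul (hp.hasDerivAt x)).const_mul (2 / a)
  have hd : deriv p = fun x => 2 / a * (u x * p x) := funext fun x => (hp.hasDerivAt x).deriv
  refine ⟨ContDiff.contDiffOn (contDiff_two_of_hasDerivAt hp.hasDerivAt h2 ?_), fun x _ => ?_,
    fun x hx => ?_, hp.mass⟩
  · have := hp.continuous
    fun_prop
  · rw [hd]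
    have h3 := (hu x).mul (hp.hasDerivAt x)
    erw [(h2 x).deriv, h3.deriv]
    field_simp
    ring
  · have hx' : x ∈ Icc (-U) U := by
      rcases hx with rfl | rfl <;> constructor <;> linarith
    rw [(hp.hasDerivAt x).hasDerivWithinAt.derivWithin
      (uniqueDiffOn_Icc (by linarith) x hx')]
    field_simp
    ring

/-- The equation says the flux `(a/2) q' - u q` is constant, and the boundary condition makes it
zero. Then `q` and `p` solve the same first-order linear equation, so `q / p` is constant, and the
mass fixes the constant. -/
lemma eqOn (hp : IsGibbsDensity a U u p) (ha : 0 < a) (hU : 0 < U)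
    (hu : ∀ x, HasDerivAt u (u' x) x) {q : ℝ → ℝ} (hq : IsReflectedDensity a U u q) :
    EqOn q p (Icc (-U) U) := by
  have huc : Continuous u := continuous_iff_continuousAt.2 fun x => (hu x).continuousAt
  have hUU : -U < U := by linarith
  have hqd {x : ℝ} (hx : x ∈ Ioo (-U) U) : ContDiffAt ℝ 2 q x :=
    hq.smooth.contDiffAt (Icc_mem_nhds hx.1 hx.2)
  have hflux {x : ℝ} (hx : x ∈ Icc (-U) U) :
      a / 2 * derivWithin q (Icc (-U) U) x - u x * q x = 0 := by
    rw [← hq.flux (-U) (by simp)]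
    refine eq_left_of_hasDerivAt_zero
      (f := fun x => a / 2 * derivWithin q (Icc (-U) U) x - u x * q x) ?_ (fun y hy => ?_) hx
    · exact (continuousOn_const.mul (hq.smooth.continuousOn_derivWithin
        (uniqueDiffOn_Icc hUU) (by simp))).sub (huc.continuousOn.mul hq.smooth.continuousOn)
    · have e : (fun x => a / 2 * deriv q x - u x * q x) =ᶠ[𝓝 y]
          fun x => a / 2 * derivWithin q (Icc (-U) U) x - u x * q x := by
        filter_upwards [isOpen_Ioo.mem_nhds hy] with z hz
        rw [derivWithin_of_mem_nhds (Icc_mem_nhds hz.1 hz.2)]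
      have d1 : DifferentiableAt ℝ (deriv q) y :=
        (((hq.smooth.mono Ioo_subset_Icc_self).deriv_of_isOpen (m := 1) isOpen_Ioo
          (by norm_num)).differentiableOn (by simp)).differentiableAt (isOpen_Ioo.mem_nhds hy)
      have d2 : DifferentiableAt ℝ (fun x => u x * q x) y :=
        (hu y).differentiableAt.mul ((hqd hy).differentiableAt (by simp))
      have := (d1.hasDerivAt.const_mul (a / 2)).sub d2.hasDerivAt
      rw [hq.ode y hy] at this
      exact this.congr_of_eventuallyEq e.symm
  have hquot {x : ℝ} (hx : x ∈ Icc (-U) U) : q x / p x = q (-U) / p (-U) := by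
    refine eq_left_of_hasDerivAt_zero (f := fun x => q x / p x)
      (hq.smooth.continuousOn.div hp.continuous.continuousOn fun y _ => (hp.pos y).ne')
      (fun y hy => ?_) hx
    have h1 := hflux (Ioo_subset_Icc_self hy)
    rw [derivWithin_of_mem_nhds (Icc_mem_nhds hy.1 hy.2)] at h1
    refine (((hqd hy).differentiableAt (by simp)).hasDerivAt.div (hp.hasDerivAt y)
      (hp.pos y).ne').congr_deriv ?_
    have h2 : deriv q y = 2 / a * (u y * q y) := by
      field_simp
      linarith
    rw [h2]
    ring
  set k := q (-U) / p (-U)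
  have hqk {x : ℝ} (hx : x ∈ Icc (-U) U) : q x = k * p x := by
    rw [← hquot hx, div_mul_cancel₀ _ (hp.pos x).ne']
  have hk : k = 1 := by
    rw [← hq.mass, intervalIntegral.integral_congr (g := fun x => k * p x) fun x hx => hqk ?_,
      intervalIntegral.integral_const_mul, hp.mass, mul_one]
    rwa [uIcc_of_le hUU.le] at hx
  intro x hx
  rw [hqk hx, hk, one_mul]

section graph

variable {F : ℝ × ℝ → ℝ}

lemma integrable_graphMeasure (hp : IsGibbsDensity a U u p) (hu : Continuous u)
    (hF : Continuous F) : Integrable F (graphMeasure U u p) := by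
  rw [graphMeasure, integrable_map_measure hF.aestronglyMeasurable (by fun_prop)]
  have := hp.continuous
  change Integrable _ (Measure.withDensity _ fun x => ((p x).toNNReal : ℝ≥0∞))
  rw [integrable_withDensity_iff_integrable_smul (by fun_prop)]
  refine Continuous.integrableOn_Icc ?_
  simp only [NNReal.smul_def]
  fun_prop

lemma integral_graphMeasure (hp : IsGibbsDensity a U u p) (hU : 0 < U) (hu : Continuous u)
    (hF : Continuous F) :
    ∫ z, F z ∂(graphMeasure U u p) = ∫ x in (-U)..U, p x * F (x, u x) := by
  have := hp.continuous
  rw [graphMeasure, integral_map (by fun_prop) hF.aestronglyMeasurable]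
  change ∫ x, _ ∂(Measure.withDensity _ fun x => ((p x).toNNReal : ℝ≥0∞)) = _
  rw [integral_withDensity_eq_integral_smul (by fun_prop), integral_Icc_eq_integral_Ioc,
    intervalIntegral.integral_of_le (by linarith)]
  simp only [NNReal.smul_def, Real.coe_toNNReal _ (hp.pos _).le, smul_eq_mul]

lemma isProbabilityMeasure_graphMeasure (hp : IsGibbsDensity a U u p) (hU : 0 < U)
    (hu : Continuous u) : IsProbabilityMeasure (graphMeasure U u p) := by
  have := hp.continuous
  refine ⟨?_⟩
  rw [graphMeasure, Measure.map_apply (by fun_prop) MeasurableSet.univ, preimage_univ,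
    withDensity_apply _ MeasurableSet.univ, Measure.restrict_univ,
    ← ofReal_integral_eq_lintegral_ofReal hp.continuous.integrableOn_Icc
      (ae_of_all _ fun x => (hp.pos x).le), integral_Icc_eq_integral_Ioc,
    ← intervalIntegral.integral_of_le (by linarith), hp.mass, ENNReal.ofReal_one]

/-- Integration by parts against a reflected density. -/
lemma integral_opA (hp : IsGibbsDensity a U u p) (ha : 0 < a) (hU : 0 < U) (hu : Continuous u)
    {f : ℝ → ℝ} (hf : ContDiff ℝ 2 f) :
    Continuous (opA a f) ∧ ∫ z, opA a f z ∂(graphMeasure U u p) =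
      a / 2 * p U * deriv f U - a / 2 * p (-U) * deriv f (-U) := by
  have h1 : ContDiff ℝ 1 (deriv f) := hf.iterate_deriv' 1 1
  have c1 := h1.continuous
  have c2 := h1.continuous_deriv_one
  have c0 := hp.continuous
  have hc : Continuous (opA a f) := by
    unfold opA
    fun_prop
  refine ⟨hc, ?_⟩
  have hi : Continuous fun x => p x * opA a f (x, u x) := by fun_prop
  rw [hp.integral_graphMeasure hU hu hc,
    intervalIntegral.integral_eq_sub_of_hasDerivAt (f := fun x => a / 2 * p x * deriv f x)
      (fun x _ => ?_) (hi.intervalIntegrable _ _)]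
  -- Because `(a/2) p' = u p`, the derivative of `(a/2) p f'` is exactly `p` times `A f`.
  refine (((hp.hasDerivAt x).const_mul (a / 2)).mul
    (h1.differentiable (by simp) x).hasDerivAt).congr_deriv ?_
  rw [opA]
  field_simp
  ring

lemma integral_boundaryMeasure (hp : IsGibbsDensity a U u p) (ha : 0 < a) (G : SingPt → ℝ) :
    Integrable G (boundaryMeasure a U p) ∧ ∫ z, G z ∂(boundaryMeasure a U p) =
      a / 2 * p (-U) * G (-U, dirUp, 0) + a / 2 * p U * G (U, dirDown, 0) := by
  have hi (z : SingPt) (t : ℝ) : Integrable G (ENNReal.ofReal t • Measure.dirac z) :=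
    (integrable_dirac (by simp)).smul_measure ENNReal.ofReal_ne_top
  have hpos (x : ℝ) : 0 ≤ a / 2 * p x := by have := (hp.pos x).le; positivity
  refine ⟨(hi _ _).add_measure (hi _ _), ?_⟩
  rw [boundaryMeasure, integral_add_measure (hi _ _) (hi _ _), integral_smul_measure,
    integral_smul_measure, integral_dirac, integral_dirac, ENNReal.toReal_ofReal (hpos _),
    ENNReal.toReal_ofReal (hpos _), smul_eq_mul, smul_eq_mul]

lemma feasible (hp : IsGibbsDensity a U u p) (ha : 0 < a) (hU : 0 < U) (hu : Continuous u)
    {B : (ℝ → ℝ) → SingPt → ℝ} (hB : ∀ f x γ, B f (x, γ, 0) = (γ : ℝ) * deriv f x) :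
    Feasible a B (graphMeasure U u p) (boundaryMeasure a U p) where
  prob := hp.isProbabilityMeasure_graphMeasure hU hu
  finite := by
    unfold boundaryMeasure
    have (z : SingPt) (t : ℝ) : IsFiniteMeasure (ENNReal.ofReal t • Measure.dirac z) :=
      Measure.smul_finite _ ENNReal.ofReal_ne_top
    infer_instance
  integrable_A f hf := hp.integrable_graphMeasure hu (hp.integral_opA ha hU hu hf.1).1
  integrable_B f _ := (hp.integral_boundaryMeasure ha _).1
  constraint f hf := by
    rw [(hp.integral_opA ha hU hu hf.1).2, (hp.integral_boundaryMeasure ha _).2, hB, hB]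
    simp only [dirUp, dirDown]
    ring

end graph

end IsGibbsDensity

/-! ### Optimality of the reflected pair -/

namespace IsHJBSolution

variable {a r l h c U : ℝ} {w v v' : ℝ → ℝ}

/-- With `u = -w'/(2l)`, the zero-flux equation reads `p' = -(w'/(al)) p`, solved by a normalised
`exp(-w/(al))`. -/
lemma exists_isGibbsDensity (hs : IsHJBSolution a r l h c U w v v') (ha : 0 < a) (hl : 0 < l)
    (hU : 0 < U) : ∃ p, IsGibbsDensity a U (fun x => -v x / (2 * l)) p := by
  have hwc : Continuous w := hs.contDiff.continuous
  set e : ℝ → ℝ := fun x => Real.exp (-w x / (a * l))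
  have hec : Continuous e := by fun_prop
  have hm : 0 < ∫ x in (-U)..U, e x :=
    intervalIntegral.intervalIntegral_pos_of_pos (hec.intervalIntegrable _ _)
      (fun x => Real.exp_pos _) (by linarith)
  refine ⟨fun x => (∫ x in (-U)..U, e x)⁻¹ * e x, fun x => ?_, fun x => ?_, ?_⟩
  · exact mul_pos (inv_pos.2 hm) (Real.exp_pos _)
  · refine ((((hs.deriv_fst x).neg.div_const (a * l)).exp).const_mul _).congr_deriv ?_
    simp only [e, Pi.neg_apply]
    field_simp
  · rw [intervalIntegral.integral_const_mul, inv_mul_cancel₀ hm.ne']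

lemma cost_eq (hs : IsHJBSolution a r l h c U w v v') (ha : 0 < a) (hr : 0 < r) (hl : 0 < l)
    (hh : 0 < h) (hU : 0 < U) {p : ℝ → ℝ} (hp : IsGibbsDensity a U (fun x => -v x / (2 * l)) p) :
    cost r l h (graphMeasure U (fun x => -v x / (2 * l)) p) (boundaryMeasure a U p) =
      ENNReal.ofReal c := by
  have hvc := hs.continuous_fst
  have hu : Continuous fun x => -v x / (2 * l) := by fun_prop
  have := hp.isProbabilityMeasure_graphMeasure hU hu
  have hFc : Continuous fun z : ℝ × ℝ => r * z.1 ^ 2 + l * z.2 ^ 2 := by fun_prop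
  have hF := hp.integrable_graphMeasure hu hFc
  obtain ⟨hAc, hA⟩ := hp.integral_opA ha hU hu hs.contDiff
  have hAi := hp.integrable_graphMeasure hu hAc
  obtain ⟨hGi, hG⟩ := hp.integral_boundaryMeasure ha fun z => h * |(z.2.1 : ℝ)|
  have hsum : ∫ z : ℝ × ℝ, (r * z.1 ^ 2 + l * z.2 ^ 2)
      ∂(graphMeasure U (fun x => -v x / (2 * l)) p) +
      ∫ z, opA a w z ∂(graphMeasure U (fun x => -v x / (2 * l)) p) = c := by
    rw [← integral_add hF hAi, hp.integral_graphMeasure hU hu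
      (F := fun z => r * z.1 ^ 2 + l * z.2 ^ 2 + opA a w z) (hFc.add hAc),
      intervalIntegral.integral_congr (g := fun x => p x * c) fun x hx => ?_,
      intervalIntegral.integral_mul_const, hp.mass, one_mul]
    rw [uIcc_of_le (by linarith)] at hx
    have h1 := hs.eq_inside x (_root_.abs_le.2 hx)
    simp only [opA, hs.deriv_eq, (hs.deriv_snd _).deriv, ← h1]
    field_simp
    ring
  -- The running cost is `c - ∫ A w`, and `∫ A w = (a/2) h (p(U) + p(-U))` is precisely the boundary
  -- cost.
  rw [cost, ← ofReal_integral_eq_lintegral_ofReal hF (ae_of_all _ fun z => by positivity),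
    ← ofReal_integral_eq_lintegral_ofReal hGi (ae_of_all _ fun z => by positivity),
    ← ENNReal.ofReal_add (integral_nonneg fun z => by positivity)
      (integral_nonneg fun z => by positivity), hG, eq_sub_of_add_eq hsum, hA,
    hs.deriv_eq, hs.right, hs.left, abs_dir, abs_dir]
  congr 1
  ring

lemma lpValue_eq (hs : IsHJBSolution a r l h c U w v v') (hr : 0 < r) (hl : 0 < l)
    (hh : 0 < h) {B : (ℝ → ℝ) → SingPt → ℝ} (hB : IsDirectional B)
    {μ : Measure (ℝ × ℝ)} {ρ : Measure SingPt} (hf : Feasible a B μ ρ)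
    (hc : cost r l h μ ρ = ENNReal.ofReal c) : lpValue a r l h B = ENNReal.ofReal c :=
  le_antisymm ((iInf_le_of_le μ (iInf_le_of_le ρ (iInf_le _ hf))).trans_eq hc)
    (le_iInf fun _ => le_iInf fun _ => le_iInf fun hf' => hs.le_cost hr hl hh hB hf')

end IsHJBSolution

end SingularLP

theorem mainTheorem8 (a r l h : ℝ) (ha : 0 < a) (hr : 0 < r) (hl : 0 < l) (hh : 0 < h) :
    ∃ ι ∈ Set.Ioo (0 : ℝ) 1, ∃ U : ℝ, 0 < U ∧
      -- `w` is a classical solution of the HJB equation, and `u*` is the pointwise minimiser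
      ContDiff ℝ 2 (SingularLP.valueFn a r l h ι U) ∧
      (∀ x : ℝ, SingularLP.HJBAt a r l h (ι * a * √(r * l)) (SingularLP.valueFn a r l h ι U) x) ∧
      (∀ x : ℝ, IsMinOn
        (fun u => SingularLP.opA a (SingularLP.valueFn a r l h ι U) (x, u)
          + (r * x ^ 2 + l * u ^ 2))
        Set.univ (SingularLP.optControl a r l h ι U x)) ∧
      -- the value of the linear program
      SingularLP.lpValue a r l h SingularLP.opBGrad = ENNReal.ofReal (ι * a * √(r * l)) ∧
      SingularLP.lpValue a r l h SingularLP.opBJump = ENNReal.ofReal (ι * a * √(r * l)) ∧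
      -- the stationary density, and the optimal pair
      ∃ p : ℝ → ℝ,
        SingularLP.IsReflectedDensity a U (SingularLP.optControl a r l h ι U) p ∧
        (∀ q : ℝ → ℝ,
          SingularLP.IsReflectedDensity a U (SingularLP.optControl a r l h ι U) q →
            Set.EqOn q p (Set.Icc (-U) U)) ∧
        (∀ x ∈ Set.Icc (-U) U, 0 ≤ p x) ∧
        SingularLP.Feasible a SingularLP.opBGrad
          (SingularLP.graphMeasure U (SingularLP.optControl a r l h ι U) p)
          (SingularLP.boundaryMeasure a U p) ∧
        SingularLP.Feasible a SingularLP.opBJump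
          (SingularLP.graphMeasure U (SingularLP.optControl a r l h ι U) p)
          (SingularLP.boundaryMeasure a U p) ∧
        SingularLP.cost r l h
          (SingularLP.graphMeasure U (SingularLP.optControl a r l h ι U) p)
          (SingularLP.boundaryMeasure a U p) = ENNReal.ofReal (ι * a * √(r * l)) := by
  obtain ⟨ι, hι, U, hU, hUeq, hslope⟩ := SingularLP.exists_innerSlope_eq ha hr hl hh
  obtain ⟨v, v', hs⟩ := SingularLP.isHJBSolution_valueFn ha hr hl hh hι.1.le hι.2.le hU hUeq hslope
  obtain ⟨p, hp⟩ := hs.exists_isGibbsDensity ha hl hU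
  have hopt : SingularLP.optControl a r l h ι U = fun x => -v x / (2 * l) := by
    funext x
    rw [SingularLP.optControl, hs.deriv_eq]
  have hu (x : ℝ) : HasDerivAt (fun x => -v x / (2 * l)) (-v' x / (2 * l)) x :=
    (hs.deriv_snd x).neg.div_const _
  have huc : Continuous fun x => -v x / (2 * l) := hs.continuous_fst.neg.div_const _
  have hcost := hs.cost_eq ha hr hl hh hU hp
  have hf1 : SingularLP.Feasible a SingularLP.opBGrad _ _ := hp.feasible ha hU huc fun _ _ _ => rfl
  have hf2 : SingularLP.Feasible a SingularLP.opBJump _ _ :=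
    hp.feasible ha hU huc fun _ _ _ => by simp [SingularLP.opBJump]
  refine ⟨ι, hι, U, hU, hs.contDiff, hs.hjbAt hl, hs.isMinOn hl,
    hs.lpValue_eq hr hl hh SingularLP.isDirectional_opBGrad hf1 hcost,
    hs.lpValue_eq hr hl hh SingularLP.isDirectional_opBJump hf2 hcost, p, ?_⟩
  rw [hopt]
  exact ⟨hp.isReflectedDensity ha hU hu (hs.continuous.neg.div_const _),
    fun q hq => hp.eqOn ha hU hu hq, fun x _ => (hp.pos x).le, hf1, hf2, hcost⟩
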